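/- \textbf{Setting.} Fix a key length $\kappa\ge 0$ and a random oracle $\mathcal H$, i.e. a uniformly random function from bit strings (of all lengths up to some bound that is at least $2\kappa$) to $\{0,1\}^{\ell}$, with arbitrary output length $\ell$. The encryption scheme $\mathsf{KDMP}$ is: $\mathsf{KeyGen}(1^\kappa)$ outputs $sk\leftarrow_r\{0,1\}^\kappa$; $\mathsf{Enc}_{sk}(m)$, for a message $m$ of at most $\ell$ bits, samples $R_1,R_2\leftarrow_r\{0,1\}^\kappa$ and outputs the ciphertext $(R_1,\mathcal H(sk\|R_1)\oplus m)$, where $\mathcal H(sk\|R_1)$ is truncated to the length of $m$, together with the key tag $(R_2,\mathcal H(sk\|R_2))$. For $q'\ge 0$ let $\mathcal F[q']$ be the set of deterministic classical functions $f(K,msg)$ of a list $K$ of keys and a bit string $msg$ of a length fixed by $f$, with outputs of a fixed length (at most $\ell$), which make at most $q'$ classical, possibly adaptive, queries to $\mathcal H$. The non-adaptive symmetric-key KDM game with parameters $(\kappa,L,T,q)$ and challenge bit $b$ between a challenger and a quantum adversary $\mathscr A$ is as follows. (1) The challenger samples independent keys $K=(sk_1,\dots,sk_L)$ with $\mathsf{KeyGen}(1^\kappa)$.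 (2) The adversary picks $T$ triples $(i,f,msg)$ with $i\in\{1,\dots,L\}$, $f\in\mathcal F[q']$ and $msg$ of a length compatible with $f$. After receiving all of them, the challenger returns, for each triple, $\mathsf{Enc}_{sk_i}(f(K,msg))$ (with its key tag) if $b=1$, and $\mathsf{Enc}_{sk_i}(0^{|f(K,msg)|})$ (with its key tag) if $b=0$. (3) The adversary runs a quantum distinguisher on the answers and outputs a bit $b'$. The adversary may query $\mathcal H$ in superposition, through the unitary $|x\rangle|y\rangle\mapsto|x\rangle|y\oplus\mathcal H(x)\rangle$, at most $q$ times in total (both while choosing its triples and in the distinguisher), and is otherwise computationally unbounded. Its advantage is $$\mathsf{Adv}^{naSymKDM}_{\mathsf{KDMP},\mathcal F[q']}(\mathscr A_{(L,T,q)},\kappa)=\bigl|\Pr(b'=1\mid b=1)-\Pr(b'=1\mid b=0)\bigr|.$$ \textbf{Theorem.} There is a fixed polynomial $\mathsf{poly}$ in four variables such that for all $\kappa,L,T,q,q'$ (and all lengths of the oracle's inputs and outputs as above) and every such adversary $\mathscr A$, $$\mathsf{Adv}^{naSymKDM}_{\mathsf{KDMP},\mathcal F[q']}(\mathscr A_{(L,T,q)},\kappa)\le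 \mathsf{poly}(q,q',L,T)\cdot 2^{-0.5\kappa}.$$ Consequently $\mathsf{KDMP}$ is non-adaptively KDM secure in the quantum random oracle model: if $L(\kappa),T(\kappa),q(\kappa),q'(\kappa)$ are bounded by polynomials in $\kappa$, then for every family of such adversaries the advantage is a negligible function of $\kappa$. -/

import Mathlib

open scoped BigOperators

noncomputable section

namespace KDM

/-! ### Bit strings and the random oracle -/

/-- Bit strings of length `n`. -/
abbrev Bits (n : ℕ) : Type := Fin n → Bool

/-- Bitwise exclusive or. -/
def bxor {n : ℕ} (a b : Bits n) : Bits n := fun i => xor (a i) (b i)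

/-- Inputs of the random oracle: all bit strings of length at most `2 κ + e`. They include
the strings `sk ‖ R` of length `2 κ` used by the scheme, and strings of other lengths. -/
abbrev OracleIn (κ e : ℕ) : Type := Σ n : Fin (2 * κ + e + 1), Bits n

/-- A (classical table of the) random oracle, with outputs of `ℓ` bits. -/
abbrev Oracle (κ e ℓ : ℕ) : Type := OracleIn κ e → Bits ℓ

/-- The concatenation `sk ‖ R` as an oracle input. -/
def concat {κ e : ℕ} (sk R : Bits κ) : OracleIn κ e :=
  ⟨⟨κ + κ, by omega⟩, Fin.append sk R⟩

/-! ### Classical functions with oracle access -/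

/-- Deterministic classical computations with (adaptive) oracle queries: either return a value,
or query the oracle on `x` and continue depending on the answer. -/
inductive OracleProg (X Y α : Type) : Type
  | ret (a : α) : OracleProg X Y α
  | query (x : X) (k : Y → OracleProg X Y α) : OracleProg X Y α

/-- The value computed when the oracle is `H`. -/
def OracleProg.eval {X Y α : Type} (H : X → Y) : OracleProg X Y α → α
  | .ret a => a
  | .query x k => (k (H x)).eval H

/-- The computation makes at most `n` queries, whatever the answers are. -/
def OracleProg.QueriesAtMost {X Y α : Type} : ℕ → OracleProg X Y α → Prop
  | _, .ret _ => True
  | 0, .query _ _ => False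
  | n + 1, .query _ k => ∀ y, (k y).QueriesAtMost n

/-- The function family `F[q']`: classical functions `f(K, msg)` of the `L` keys and a message,
with outputs of a fixed length `outLen` (at most the oracle's output length, so that outputs can
be encrypted), making at most `q'` classical oracle queries. -/
structure KDMFunction (κ e ℓ L q' : ℕ) where
  msgLen : ℕ
  outLen : ℕ
  outLen_le : outLen ≤ ℓ
  prog : (Fin L → Bits κ) → Bits msgLen → OracleProg (OracleIn κ e) (Bits ℓ) (Bits outLen)
  prog_queries : ∀ K msg, (prog K msg).QueriesAtMost q'

/-- The value `f(K, msg)` relative to the oracle `H`. -/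
def KDMFunction.eval {κ e ℓ L q' : ℕ} (f : KDMFunction κ e ℓ L q') (H : Oracle κ e ℓ)
    (K : Fin L → Bits κ) (msg : Bits f.msgLen) : Bits f.outLen :=
  (f.prog K msg).eval H

/-- An encryption query: a key index, a function and a message of compatible length. -/
structure EncQuery (κ e ℓ L q' : ℕ) where
  idx : Fin L
  f : KDMFunction κ e ℓ L q'
  msg : Bits f.msgLen

/-! ### The encryption scheme -/

/-- What `Enc` outputs on a message of `n` bits: a ciphertext `(R₁, c₂)` and a key tag
`(R₂, t₂)`. -/
structure Ciphertext (κ ℓ n : ℕ) where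
  ct : Bits κ × Bits n
  tag : Bits κ × Bits ℓ

/-- `Enc_sk(m) = ((R₁, H(sk ‖ R₁) ⊕ m), (R₂, H(sk ‖ R₂)))` with random coins `R₁, R₂`. When the
message is shorter than the oracle's output, the first `n` bits of `H(sk ‖ R₁)` are the pad. -/
def enc {κ e ℓ n : ℕ} (hn : n ≤ ℓ) (H : Oracle κ e ℓ) (sk : Bits κ) (R₁ R₂ : Bits κ)
    (m : Bits n) : Ciphertext κ ℓ n where
  ct := (R₁, bxor (fun i => H (concat sk R₁) (Fin.castLE hn i)) m)
  tag := (R₂, H (concat sk R₂))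

/-! ### Quantum oracle algorithms -/

/-- Computational basis of the query-input, query-output and work registers. -/
abbrev QBasis (κ e ℓ d : ℕ) : Type := OracleIn κ e × Bits ℓ × Fin d

/-- The Hilbert space of the registers. -/
abbrev QState (κ e ℓ d : ℕ) : Type := EuclideanSpace ℂ (QBasis κ e ℓ d)

/-- Unitary operators on the registers. -/
abbrev QUnitary (κ e ℓ d : ℕ) : Type := QState κ e ℓ d ≃ₗᵢ[ℂ] QState κ e ℓ d

/-- The action `(x, y, w) ↦ (x, y ⊕ H(x), w)` of an oracle query on the computational basis. -/
def queryPerm {κ e ℓ d : ℕ} (H : Oracle κ e ℓ) : Equiv.Perm (QBasis κ e ℓ d) :=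
  Function.Involutive.toPerm (fun z => (z.1, bxor z.2.1 (H z.1), z.2.2)) (by
    rintro ⟨x, y, w⟩
    have h : bxor (bxor y (H x)) (H x) = y := by
      funext i
      simp [bxor]
    simp [h])

/-- A quantum oracle query: the unitary `|x, y, w⟩ ↦ |x, y ⊕ H(x), w⟩`. -/
def queryUnitary {κ e ℓ d : ℕ} (H : Oracle κ e ℓ) : QUnitary κ e ℓ d :=
  LinearIsometryEquiv.piLpCongrLeft 2 ℂ ℂ (queryPerm H)

/-- `U_n O_H U_{n-1} ⋯ O_H U_0 ψ`: the circuit `U` with `n` oracle queries. -/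
def runCircuit {κ e ℓ d : ℕ} (H : Oracle κ e ℓ) (U : ℕ → QUnitary κ e ℓ d) :
    ℕ → QState κ e ℓ d → QState κ e ℓ d
  | 0, ψ => U 0 ψ
  | n + 1, ψ => U (n + 1) (queryUnitary H (runCircuit H U n ψ))

/-- The (unnormalised) part of `ψ` supported on the basis states satisfying `p`. -/
def restrict {κ e ℓ d : ℕ} (p : QBasis κ e ℓ d → Bool) (ψ : QState κ e ℓ d) : QState κ e ℓ d :=
  WithLp.toLp 2 (fun z => if p z then ψ z else 0)

/-- A nonadaptive quantum adversary with parameters `(L, T, q)`, for functions in `F[q']`.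
In the first phase it runs a quantum circuit with `n₁` oracle queries and measures an outcome
`ω`, which determines its `T` encryption queries. In the second phase (the distinguisher) it gets
all `T` answers, and continues on the post-measurement state with a quantum circuit, depending on
`ω` and the answers, with `n₂` oracle queries; it then measures, and outputs `1` on the basis
states in `accept`. At most `q` quantum oracle queries are made in all, and there is no bound on
the size of the circuits. -/
structure Adversary (κ e ℓ L T q q' : ℕ) where
  /-- dimension of the work register -/
  d : ℕ
  /-- number of measurement outcomes of the first phase -/
  o : ℕ
  n₁ : ℕ
  n₂ : ℕ
  queries_le : n₁ + n₂ ≤ q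
  init : QBasis κ e ℓ d
  U₁ : ℕ → QUnitary κ e ℓ d
  outcome : QBasis κ e ℓ d → Fin o
  encQuery : Fin o → Fin T → EncQuery κ e ℓ L q'
  U₂ : (ω : Fin o) → ((j : Fin T) → Ciphertext κ ℓ (encQuery ω j).f.outLen) →
    ℕ → QUnitary κ e ℓ d
  accept : QBasis κ e ℓ d → Bool

namespace Adversary

variable {κ e ℓ L T q q' : ℕ} (A : Adversary κ e ℓ L T q q')

/-- The challenger's answers to the encryption queries, for the oracle `H`, keys `K` and
encryption coins `R`: encryptions of `f(K, msg)` if `b = 1`, of `0^{|f(K, msg)|}` if `b = 0`. -/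
def answers (b : Bool) (H : Oracle κ e ℓ) (K : Fin L → Bits κ) (R : Fin T → Bits κ × Bits κ)
    (ω : Fin A.o) (j : Fin T) : Ciphertext κ ℓ (A.encQuery ω j).f.outLen :=
  enc (A.encQuery ω j).f.outLen_le H (K (A.encQuery ω j).idx) (R j).1 (R j).2
    (if b then (A.encQuery ω j).f.eval H K (A.encQuery ω j).msg else fun _ => false)

/-- The (unnormalised) state after the first phase, when the measurement outcome is `ω`. -/
def midState (H : Oracle κ e ℓ) (ω : Fin A.o) : QState κ e ℓ A.d :=
  restrict (fun z => decide (A.outcome z = ω))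
    (runCircuit H A.U₁ A.n₁ (EuclideanSpace.single A.init 1))

/-- The (unnormalised) state at the end, when the first measurement outcome is `ω`. -/
def finalState (b : Bool) (H : Oracle κ e ℓ) (K : Fin L → Bits κ)
    (R : Fin T → Bits κ × Bits κ) (ω : Fin A.o) : QState κ e ℓ A.d :=
  runCircuit H (A.U₂ ω (A.answers b H K R ω)) A.n₂ (A.midState H ω)

/-- The probability that `b' = 1` in the game with challenge bit `b`. The oracle, the keys and
the encryption coins are uniform and independent. -/
def probOne (b : Bool) : ℝ :=
  𝔼 H : Oracle κ e ℓ, 𝔼 K : Fin L → Bits κ, 𝔼 R : Fin T → Bits κ × Bits κ,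
    ∑ ω : Fin A.o, ‖restrict A.accept (A.finalState b H K R ω)‖ ^ 2

/-- The guessing advantage in the nonadaptive symmetric-key KDM game. -/
def advantage : ℝ := |A.probOne true - A.probOne false|

end Adversary

/-- A function of the security parameter that is bounded by a polynomial. -/
def PolyBounded (f : ℕ → ℕ) : Prop := ∃ p : Polynomial ℕ, ∀ κ, f κ ≤ p.eval κ

end KDM

end

/-! Call points the oracle inputs formed from one of the `L` keys and one of the `2T` encryption
coins. Resampling a uniform oracle `H` at the points with values of a second uniform function `G`
leaves it uniform (`expect_merge`), so the game may be played with `merge (points K R) H G`. Return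
to `H` everywhere except in the challenger's own pads and tags. If the coins are distinct, these use
`G` at distinct inputs, so the answers become uniform and independent of the keys and of the
challenge bit (`expect_comp_injective`): both games are close to the same `idealProb`. Three changes
must be paid for (`sum_abs_acceptProb_merge_sub_le`). For the first phase and for the distinguisher,
the hybrid bound `norm_runCircuit_sub_sq_le` charges only the weight that the run with `H` puts on
the points. That run is independent of the keys, in the second phase because its answers are then
uniform, so each query has average weight at most `L / 2^κ`. The KDM functions know the keys, but in
the nonadaptive game they are chosen before the coins are used, so each classical query meets a
point with probability at most `2T / 2^κ`. Turning distances of states into probabilities costs a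
square root, which gives `2^(-κ/2)`. It is taken through the weighted inequality
`abs_norm_sq_sub_norm_sq_le`, which is linear in the squared distance and so passes through
averages. Colliding coins cost `4T² / 2^κ`. -/

noncomputable section

namespace KDM

/-! ### Averages over function spaces -/

/-- The function that agrees with `G` where `s` holds, and with `H` elsewhere. -/
def merge {X Y : Type} (s : X → Bool) (H G : X → Y) : X → Y := fun x => if s x then G x else H x

theorem merge_of_true {X Y : Type} {s : X → Bool} {x : X} (h : s x = true) (H G : X → Y) :
    merge s H G x = G x := by simp [merge, h]

theorem merge_of_false {X Y : Type} {s : X → Bool} {x : X} (h : s x = false) (H G : X → Y) :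
    merge s H G x = H x := by simp [merge, h]

theorem expect_expect_eq_prod {α β : Type} [Fintype α] [Fintype β] (f : α → β → ℝ) :
    𝔼 a, 𝔼 b, f a b = 𝔼 p : α × β, f p.1 p.2 := by
  rw [← Finset.univ_product_univ, Finset.expect_product' Finset.univ Finset.univ f]

/-- Reprogramming a uniform function with uniform values on a fixed set leaves it uniform. -/
theorem expect_merge {X Y : Type} [Fintype X] [DecidableEq X] [Fintype Y] [Nonempty Y]
    (s : X → Bool) (F : (X → Y) → ℝ) :
    𝔼 H : X → Y, 𝔼 G : X → Y, F (merge s H G) = 𝔼 H : X → Y, F H := by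
  -- Exchanging the values of `H` and `G` on `s` is an involution of the pairs, and its first
  -- component is `merge s H G`.
  let e : (X → Y) × (X → Y) ≃ (X → Y) × (X → Y) :=
    Function.Involutive.toPerm (fun p => (merge s p.1 p.2, merge s p.2 p.1)) (by
      rintro ⟨H, G⟩
      ext x <;> cases h : s x <;> simp [merge, h])
  rw [expect_expect_eq_prod (fun H G => F (merge s H G)),
    Fintype.expect_equiv e (fun p => F (merge s p.1 p.2)) (fun p => F p.1) (fun p => rfl),
    ← expect_expect_eq_prod (fun H _ => F H)]
  simp only [Fintype.expect_const]

theorem bxor_bxor_cancel {n : ℕ} (a b : Bits n) : bxor (bxor a b) b = a := by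
  funext i
  simp [bxor]

/-- Pointwise exclusive or with a fixed function. -/
def xorEquiv {X : Type} {n : ℕ} (δ : X → Bits n) : Equiv.Perm (X → Bits n) :=
  Function.Involutive.toPerm (fun G x => bxor (G x) (δ x)) (by
    intro G
    funext x
    exact bxor_bxor_cancel _ _)

theorem expect_xor {X : Type} [Fintype X] [DecidableEq X] {n : ℕ} (δ : X → Bits n)
    (F : (X → Bits n) → ℝ) :
    𝔼 G : X → Bits n, F (fun x => bxor (G x) (δ x)) = 𝔼 G : X → Bits n, F G :=
  Fintype.expect_equiv (xorEquiv δ) _ _ (fun _ => rfl)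

/-- The masked values of a uniform function at distinct points are uniform and independent. -/
theorem expect_comp_injective {X ι : Type} [Fintype X] [DecidableEq X] [Fintype ι]
    [DecidableEq ι] {n : ℕ} {x : ι → X} (hx : Function.Injective x) (m : ι → Bits n)
    (F : (ι → Bits n) → ℝ) :
    𝔼 G : X → Bits n, F (fun i => bxor (G (x i)) (m i)) = 𝔼 r : ι → Bits n, F r := by
  -- Shift `G` by `r` transported along `x` and extended by zero; injectivity makes this well
  -- defined. Averaging over `r` then supplies the uniform values.
  have key : ∀ r : ι → Bits n,
      𝔼 G : X → Bits n, F (fun i => bxor (r i) (bxor (G (x i)) (m i)))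
        = 𝔼 G : X → Bits n, F (fun i => bxor (G (x i)) (m i)) := by
    intro r
    rw [← expect_xor (Function.extend x r (fun _ _ => false))
      (fun G => F (fun i => bxor (G (x i)) (m i)))]
    refine Finset.expect_congr rfl fun G _ => congrArg F ?_
    funext i k
    simp only [bxor, hx.extend_apply]
    cases r i k <;> cases G (x i) k <;> cases m i k <;> rfl
  calc 𝔼 G : X → Bits n, F (fun i => bxor (G (x i)) (m i))
      = 𝔼 r : ι → Bits n, 𝔼 G : X → Bits n, F (fun i => bxor (r i) (bxor (G (x i)) (m i))) := by
        simp only [key, Fintype.expect_const]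
    _ = 𝔼 G : X → Bits n, 𝔼 r : ι → Bits n, F (fun i => bxor (r i) (bxor (G (x i)) (m i))) :=
        Finset.expect_comm _ _ _
    _ = 𝔼 r : ι → Bits n, F r := by
        simp only [expect_xor (fun i => bxor _ (m i)) F, Fintype.expect_const]

/-- A uniform coordinate meets a value that does not depend on it with probability `1 / |α|`. -/
theorem expect_coord_eq {ι α : Type} [Fintype ι] [DecidableEq ι] [Fintype α] [DecidableEq α]
    [Nonempty α] (i : ι) (g : (ι → α) → α)
    (hg : ∀ f f' : ι → α, (∀ j, j ≠ i → f j = f' j) → g f = g f') :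
    𝔼 f : ι → α, (if f i = g f then (1 : ℝ) else 0) = (Fintype.card α : ℝ)⁻¹ := by
  -- Condition on the other coordinates: the target value is then a constant.
  have key : ∀ r : {j // j ≠ i} → α,
      𝔼 a : α, (if a = g ((Equiv.funSplitAt i α).symm (a, r)) then (1 : ℝ) else 0)
        = (Fintype.card α : ℝ)⁻¹ := by
    intro r
    obtain ⟨a₀⟩ := ‹Nonempty α›
    have h : ∀ a, g ((Equiv.funSplitAt i α).symm (a, r))
        = g ((Equiv.funSplitAt i α).symm (a₀, r)) := by
      intro a
      refine hg _ _ fun j hj => ?_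
      simp [Equiv.funSplitAt, hj]
    simp only [h]
    rw [Fintype.expect_eq_sum_div_card]
    simp
  rw [Fintype.expect_equiv (Equiv.funSplitAt i α) _
    (fun p => if p.1 = g ((Equiv.funSplitAt i α).symm p) then (1 : ℝ) else 0)
    (fun f => by simp only [Equiv.symm_apply_apply]; rfl),
    ← expect_expect_eq_prod
      (fun a r => if a = g ((Equiv.funSplitAt i α).symm (a, r)) then (1 : ℝ) else 0),
    Finset.expect_comm]
  simp only [key, Fintype.expect_const]

/-! ### Quantum circuits -/

section Quantum

variable {κ e ℓ d : ℕ}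

theorem norm_restrict_sq (p : QBasis κ e ℓ d → Bool) (ψ : QState κ e ℓ d) :
    ‖restrict p ψ‖ ^ 2 = ∑ z, if p z then ‖ψ z‖ ^ 2 else 0 := by
  rw [EuclideanSpace.norm_sq_eq]
  refine Finset.sum_congr rfl fun z _ => ?_
  cases h : p z <;> simp [restrict, h]

theorem norm_restrict_le (p : QBasis κ e ℓ d → Bool) (ψ : QState κ e ℓ d) :
    ‖restrict p ψ‖ ≤ ‖ψ‖ := by
  refine le_of_sq_le_sq ?_ (norm_nonneg _)
  rw [norm_restrict_sq, EuclideanSpace.norm_sq_eq]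
  refine Finset.sum_le_sum fun z _ => ?_
  split_ifs
  · exact le_rfl
  · positivity

theorem restrict_sub (p : QBasis κ e ℓ d → Bool) (ψ φ : QState κ e ℓ d) :
    restrict p (ψ - φ) = restrict p ψ - restrict p φ := by
  ext z
  cases h : p z <;> simp [restrict, h]

theorem sum_norm_restrict_sq {o : ℕ} (g : QBasis κ e ℓ d → Fin o) (ψ : QState κ e ℓ d) :
    ∑ ω, ‖restrict (fun z => decide (g z = ω)) ψ‖ ^ 2 = ‖ψ‖ ^ 2 := by
  simp only [norm_restrict_sq]
  rw [Finset.sum_comm, EuclideanSpace.norm_sq_eq]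
  refine Finset.sum_congr rfl fun z _ => ?_
  simp

theorem norm_runCircuit (H : Oracle κ e ℓ) (U : ℕ → QUnitary κ e ℓ d) (n : ℕ)
    (ψ : QState κ e ℓ d) : ‖runCircuit H U n ψ‖ = ‖ψ‖ := by
  induction n with
  | zero => simp [runCircuit]
  | succ n ih => simp [runCircuit, ih]

theorem runCircuit_sub (H : Oracle κ e ℓ) (U : ℕ → QUnitary κ e ℓ d) (n : ℕ)
    (ψ φ : QState κ e ℓ d) :
    runCircuit H U n (ψ - φ) = runCircuit H U n ψ - runCircuit H U n φ := by
  induction n with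
  | zero => simp [runCircuit]
  | succ n ih => simp [runCircuit, ih]

theorem queryUnitary_apply (H : Oracle κ e ℓ) (ψ : QState κ e ℓ d) (z : QBasis κ e ℓ d) :
    queryUnitary H ψ z = ψ (z.1, bxor z.2.1 (H z.1), z.2.2) := rfl

/-- Two oracles that agree off `s` act in the same way off `s`. -/
theorem norm_queryUnitary_sub_le {s : OracleIn κ e → Bool} {H H' : Oracle κ e ℓ}
    (h : ∀ x, s x = false → H' x = H x) (ψ : QState κ e ℓ d) :
    ‖queryUnitary H' ψ - queryUnitary H ψ‖ ≤ 2 * ‖restrict (fun z => s z.1) ψ‖ := by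
  -- A query preserves the input register, so the parts of `ψ` off `s` cancel.
  have key : queryUnitary H' ψ - queryUnitary H ψ
      = queryUnitary H' (restrict (fun z => s z.1) ψ)
        - queryUnitary H (restrict (fun z => s z.1) ψ) := by
    ext z
    simp only [PiLp.sub_apply, queryUnitary_apply]
    cases hz : s z.1
    · simp [restrict, hz, h _ hz]
    · simp [restrict, hz]
  rw [key]
  refine (norm_sub_le _ _).trans ?_
  simp [two_mul]

/-- Exchange the oracle one query at a time, comparing on the state of the run with `H`. Only that
run appears on the right, so `s` may be random and independent of it. -/
theorem norm_runCircuit_sub_le {s : OracleIn κ e → Bool} {H H' : Oracle κ e ℓ}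
    (h : ∀ x, s x = false → H' x = H x) (U : ℕ → QUnitary κ e ℓ d) (n : ℕ)
    (ψ : QState κ e ℓ d) :
    ‖runCircuit H' U n ψ - runCircuit H U n ψ‖
      ≤ 2 * ∑ t ∈ Finset.range n, ‖restrict (fun z => s z.1) (runCircuit H U t ψ)‖ := by
  induction n with
  | zero => simp [runCircuit]
  | succ n ih =>
    rw [Finset.sum_range_succ, mul_add]
    calc ‖runCircuit H' U (n + 1) ψ - runCircuit H U (n + 1) ψ‖
        = ‖queryUnitary H' (runCircuit H' U n ψ - runCircuit H U n ψ)
            + (queryUnitary H' (runCircuit H U n ψ)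
              - queryUnitary H (runCircuit H U n ψ))‖ := by
          simp only [runCircuit]
          rw [← map_sub, LinearIsometryEquiv.norm_map, map_sub]
          congr 1
          abel
      _ ≤ _ := by
          refine (norm_add_le _ _).trans (add_le_add ?_ (norm_queryUnitary_sub_le h _))
          rw [LinearIsometryEquiv.norm_map]
          exact ih

/-- The hybrid bound: the effect of changing the oracle on `s` is controlled by the weight that
the queries of the run with the original oracle put on `s`. -/
theorem norm_runCircuit_sub_sq_le {s : OracleIn κ e → Bool} {H H' : Oracle κ e ℓ}
    (h : ∀ x, s x = false → H' x = H x) (U : ℕ → QUnitary κ e ℓ d) (n : ℕ)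
    (ψ : QState κ e ℓ d) :
    ‖runCircuit H' U n ψ - runCircuit H U n ψ‖ ^ 2
      ≤ 4 * n * ∑ t ∈ Finset.range n, ‖restrict (fun z => s z.1) (runCircuit H U t ψ)‖ ^ 2 := by
  have h₁ := pow_le_pow_left₀ (norm_nonneg _) (norm_runCircuit_sub_le h U n ψ) 2
  have h₂ := sq_sum_le_card_mul_sum_sq (s := Finset.range n)
    (f := fun t => ‖restrict (fun z => s z.1) (runCircuit H U t ψ)‖)
  rw [Finset.card_range] at h₂
  rw [mul_pow] at h₁
  linarith

/-- Young's inequality applied to `(‖u‖ + ‖v‖) * ‖u - v‖`, with a free weight `ε` in place of a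
square root of an average. -/
theorem abs_norm_sq_sub_norm_sq_le {E : Type*} [SeminormedAddCommGroup E] (u v : E) {ε : ℝ}
    (hε : 0 < ε) :
    |‖u‖ ^ 2 - ‖v‖ ^ 2| ≤ ε * (‖u‖ ^ 2 + ‖v‖ ^ 2) + ‖u - v‖ ^ 2 / (2 * ε) := by
  have h₁ : |‖u‖ ^ 2 - ‖v‖ ^ 2| ≤ (‖u‖ + ‖v‖) * ‖u - v‖ := by
    rw [sq_sub_sq, abs_mul, abs_of_nonneg (by positivity : 0 ≤ ‖u‖ + ‖v‖)]
    exact mul_le_mul_of_nonneg_left (abs_norm_sub_norm_le u v) (by positivity)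
  have h₂ : ε * (‖u‖ ^ 2 + ‖v‖ ^ 2) + ‖u - v‖ ^ 2 / (2 * ε) - (‖u‖ + ‖v‖) * ‖u - v‖
      = (ε * (‖u‖ + ‖v‖) - ‖u - v‖) ^ 2 / (2 * ε) + ε / 2 * (‖u‖ - ‖v‖) ^ 2 := by
    field_simp
    ring
  have h₃ : 0 ≤ (ε * (‖u‖ + ‖v‖) - ‖u - v‖) ^ 2 / (2 * ε) + ε / 2 * (‖u‖ - ‖v‖) ^ 2 := by
    positivity
  linarith

end Quantum

/-! ### Oracle computations -/

/-- The queries of a computation when the oracle is `H`. -/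
def OracleProg.queries {X Y α : Type} (H : X → Y) : OracleProg X Y α → List X
  | .ret _ => []
  | .query x k => x :: (k (H x)).queries H

theorem OracleProg.length_queries_le {X Y α : Type} (H : X → Y) :
    ∀ (P : OracleProg X Y α) (n : ℕ), P.QueriesAtMost n → (P.queries H).length ≤ n
  | .ret _, _, _ => by simp [OracleProg.queries]
  | .query _ _, 0, h => h.elim
  | .query x k, n + 1, h => by
    simpa [OracleProg.queries] using OracleProg.length_queries_le H (k (H x)) n (h _)

/-- Agreement on the queries made under `H` suffices despite adaptivity, since the computation then
follows the same path. -/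
theorem OracleProg.eval_congr {X Y α : Type} {H H' : X → Y} :
    ∀ P : OracleProg X Y α, (∀ x ∈ P.queries H, H' x = H x) → P.eval H' = P.eval H
  | .ret _, _ => rfl
  | .query x k, h => by
    simp only [OracleProg.queries, List.mem_cons, forall_eq_or_imp] at h
    simp only [OracleProg.eval, h.1]
    exact OracleProg.eval_congr (k (H x)) h.2

/-! ### The reprogrammed points -/

theorem concat_inj {κ e : ℕ} {a b a' b' : Bits κ}
    (h : (concat a b : OracleIn κ e) = concat a' b') : a = a' ∧ b = b' := by
  simp only [concat, Sigma.mk.injEq, heq_eq_eq, true_and] at h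
  constructor
  · funext i
    simpa using congrFun h (Fin.castAdd κ i)
  · funext i
    have hi := congrFun h (Fin.natAdd κ i)
    rwa [Fin.append_right, Fin.append_right] at hi

section Points

variable {κ e L T : ℕ}

/-- The encryption coins as a single family: `(j, false)` is the coin of the `j`-th ciphertext,
`(j, true)` the coin of its key tag. -/
def coin (R : Fin T → Bits κ × Bits κ) (p : Fin T × Bool) : Bits κ :=
  if p.2 then (R p.1).2 else (R p.1).1

/-- The correspondence between the encryption coins and the single family of coins. -/
def coinEquiv : (Fin T → Bits κ × Bits κ) ≃ (Fin T × Bool → Bits κ) where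
  toFun := coin
  invFun ρ j := (ρ (j, false), ρ (j, true))
  left_inv R := rfl
  right_inv ρ := by
    funext ⟨j, b⟩
    cases b <;> rfl

/-- The oracle inputs formed by one of the keys and one of the coins. -/
def points (K : Fin L → Bits κ) (R : Fin T → Bits κ × Bits κ) (x : OracleIn κ e) : Bool :=
  decide (∃ i p, x = concat (K i) (coin R p))

theorem points_concat (K : Fin L → Bits κ) (R : Fin T → Bits κ × Bits κ) (i : Fin L)
    (p : Fin T × Bool) : points K R (concat (K i) (coin R p) : OracleIn κ e) = true :=
  decide_eq_true ⟨i, p, rfl⟩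

theorem card_bits (n : ℕ) : (Fintype.card (Bits n) : ℝ) = 2 ^ n := by
  simp

/-- An input that is independent of the keys is among the points with small probability. -/
theorem expect_points_keys_le (R : Fin T → Bits κ × Bits κ) (x : OracleIn κ e) :
    𝔼 K : Fin L → Bits κ, (if points K R x then (1 : ℝ) else 0) ≤ L * (2 ^ κ : ℝ)⁻¹ := by
  by_cases hx : ∃ a b, x = concat a b
  · obtain ⟨a, b, rfl⟩ := hx
    calc 𝔼 K : Fin L → Bits κ, (if points K R (concat a b : OracleIn κ e) then (1 : ℝ) else 0)
        ≤ 𝔼 K : Fin L → Bits κ, ∑ i, (if K i = a then (1 : ℝ) else 0) := by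
          refine Finset.expect_le_expect fun K _ => ?_
          split_ifs with h
          · obtain ⟨i, p, hip⟩ := of_decide_eq_true h
            refine le_trans ?_ (Finset.single_le_sum (f := fun i => if K i = a then (1 : ℝ) else 0)
              (fun i _ => by positivity) (Finset.mem_univ i))
            simp [(concat_inj hip).1]
          · positivity
      _ = L * (2 ^ κ : ℝ)⁻¹ := by
          rw [Finset.expect_sum_comm]
          simp only [fun i => expect_coord_eq (ι := Fin L) i (fun _ => a) (fun _ _ _ => rfl),
            card_bits]
          simp
  · refine le_trans (le_of_eq ?_) (by positivity : (0 : ℝ) ≤ _)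
    refine Finset.expect_eq_zero fun K _ => ?_
    rw [if_neg]
    intro h
    obtain ⟨i, p, hip⟩ := of_decide_eq_true h
    exact hx ⟨_, _, hip⟩

theorem expect_coin_eq (F : (Fin T × Bool → Bits κ) → ℝ) :
    𝔼 R : Fin T → Bits κ × Bits κ, F (coin R) = 𝔼 ρ : Fin T × Bool → Bits κ, F ρ :=
  Fintype.expect_equiv coinEquiv _ _ (fun _ => rfl)

/-- An input that is independent of the coins is among the points with small probability. -/
theorem expect_points_coins_le (K : Fin L → Bits κ) (x : OracleIn κ e) :
    𝔼 R : Fin T → Bits κ × Bits κ, (if points K R x then (1 : ℝ) else 0)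
      ≤ 2 * T * (2 ^ κ : ℝ)⁻¹ := by
  by_cases hx : ∃ a b, x = concat a b
  · obtain ⟨a, b, rfl⟩ := hx
    calc 𝔼 R : Fin T → Bits κ × Bits κ,
          (if points K R (concat a b : OracleIn κ e) then (1 : ℝ) else 0)
        ≤ 𝔼 R : Fin T → Bits κ × Bits κ, ∑ p, (if coin R p = b then (1 : ℝ) else 0) := by
          refine Finset.expect_le_expect fun R _ => ?_
          split_ifs with h
          · obtain ⟨i, p, hip⟩ := of_decide_eq_true h
            refine le_trans ?_ (Finset.single_le_sum
              (f := fun p => if coin R p = b then (1 : ℝ) else 0)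
              (fun i _ => by positivity) (Finset.mem_univ p))
            simp [(concat_inj hip).2]
          · positivity
      _ = 2 * T * (2 ^ κ : ℝ)⁻¹ := by
          rw [expect_coin_eq (fun ρ => ∑ p, (if ρ p = b then (1 : ℝ) else 0)),
            Finset.expect_sum_comm]
          simp only [fun p => expect_coord_eq (ι := Fin T × Bool) p (fun _ => b) (fun _ _ _ => rfl),
            card_bits]
          simp
          ring
  · refine le_trans (le_of_eq ?_) (by positivity : (0 : ℝ) ≤ _)
    refine Finset.expect_eq_zero fun K _ => ?_
    rw [if_neg]
    intro h
    obtain ⟨i, p, hip⟩ := of_decide_eq_true h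
    exact hx ⟨_, _, hip⟩

open Classical in
/-- The coins collide with small probability. -/
theorem expect_not_injective_coin_le :
    𝔼 R : Fin T → Bits κ × Bits κ, (if Function.Injective (coin R) then (0 : ℝ) else 1)
      ≤ 4 * T ^ 2 * (2 ^ κ : ℝ)⁻¹ := by
  rw [expect_coin_eq (fun ρ => if Function.Injective ρ then (0 : ℝ) else 1)]
  calc 𝔼 ρ : Fin T × Bool → Bits κ, (if Function.Injective ρ then (0 : ℝ) else 1)
      ≤ 𝔼 ρ : Fin T × Bool → Bits κ, ∑ p, ∑ p', if p = p' then (0 : ℝ) else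
          if ρ p = ρ p' then 1 else 0 := by
        refine Finset.expect_le_expect fun ρ _ => ?_
        split_ifs with h
        · positivity
        · simp only [Function.Injective, not_forall] at h
          obtain ⟨p, p', h₁, h₂⟩ := h
          refine le_trans ?_ (Finset.single_le_sum (f := fun p => ∑ p', if p = p' then (0 : ℝ) else
            if ρ p = ρ p' then 1 else 0) (fun i _ => by positivity) (Finset.mem_univ p))
          refine le_trans ?_ (Finset.single_le_sum (f := fun p' => if p = p' then (0 : ℝ) else
            if ρ p = ρ p' then 1 else 0) (fun i _ => by positivity) (Finset.mem_univ p'))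
          simp [h₁, h₂]
    _ = ∑ p : Fin T × Bool, ∑ p' : Fin T × Bool, if p = p' then (0 : ℝ) else
          𝔼 ρ : Fin T × Bool → Bits κ, if ρ p = ρ p' then 1 else 0 := by
        simp only [Finset.expect_sum_comm]
        refine Finset.sum_congr rfl fun p _ => Finset.sum_congr rfl fun p' _ => ?_
        split_ifs <;> simp
    _ ≤ ∑ p : Fin T × Bool, ∑ p' : Fin T × Bool, (2 ^ κ : ℝ)⁻¹ := by
        refine Finset.sum_le_sum fun p _ => Finset.sum_le_sum fun p' _ => ?_
        split_ifs with h
        · positivity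
        · rw [expect_coord_eq p (fun ρ : Fin T × Bool → Bits κ => ρ p')
            (fun _ _ hf => hf p' (Ne.symm h)), card_bits]
    _ = 4 * T ^ 2 * (2 ^ κ : ℝ)⁻¹ := by
        simp
        ring

/-- A state that is independent of the keys has little weight on the points. -/
theorem expect_norm_restrict_points_sq_le {ℓ d : ℕ} (R : Fin T → Bits κ × Bits κ)
    (ψ : QState κ e ℓ d) :
    𝔼 K : Fin L → Bits κ, ‖restrict (fun z => points K R z.1) ψ‖ ^ 2
      ≤ L * (2 ^ κ : ℝ)⁻¹ * ‖ψ‖ ^ 2 := by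
  simp only [norm_restrict_sq]
  rw [Finset.expect_sum_comm, EuclideanSpace.norm_sq_eq, Finset.mul_sum]
  refine Finset.sum_le_sum fun z _ => ?_
  calc 𝔼 K : Fin L → Bits κ, (if points K R z.1 then ‖ψ z‖ ^ 2 else 0)
      = (𝔼 K : Fin L → Bits κ, (if points K R z.1 then (1 : ℝ) else 0)) * ‖ψ z‖ ^ 2 := by
        rw [Finset.expect_mul]
        simp
    _ ≤ _ := mul_le_mul_of_nonneg_right (expect_points_keys_le R z.1) (by positivity)

end Points

/-! ### The game -/

/-- A union bound over a list that is fixed before the randomness `a` is drawn. -/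
theorem expect_list_sum_le {α β : Type} [Fintype α] (f : α → β → ℝ) {c : ℝ}
    (h : ∀ x, 𝔼 a, f a x ≤ c) : ∀ l : List β, 𝔼 a, (l.map (f a)).sum ≤ l.length * c
  | [] => by simp
  | x :: l => by
    simp only [List.map_cons, List.sum_cons, List.length_cons, Finset.expect_add_distrib]
    push_cast
    linarith [h x, expect_list_sum_le f h l]

namespace Adversary

variable {κ e ℓ L T q q' : ℕ} (A : Adversary κ e ℓ L T q q')

/-- The probability of the outcome `ω` in a first phase with the oracle `H₁`, followed by `b' = 1`
in a second phase with the oracle `H₂` and the answers `a`. -/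
def acceptProb (H₁ H₂ : Oracle κ e ℓ) (ω : Fin A.o)
    (a : (j : Fin T) → Ciphertext κ ℓ (A.encQuery ω j).f.outLen) : ℝ :=
  ‖restrict A.accept (runCircuit H₂ (A.U₂ ω a) A.n₂ (A.midState H₁ ω))‖ ^ 2

/-- The answers with the coins `R` whose masked pads and tags are `r`. -/
def assemble (ω : Fin A.o) (R : Fin T → Bits κ × Bits κ) (r : Fin T × Bool → Bits ℓ)
    (j : Fin T) : Ciphertext κ ℓ (A.encQuery ω j).f.outLen where
  ct := ((R j).1, fun i => r (j, false) (Fin.castLE (A.encQuery ω j).f.outLen_le i))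
  tag := ((R j).2, r (j, true))

/-- The encrypted messages, padded with zeros to `ℓ` bits; the key tags encrypt zero. -/
def mask (b : Bool) (H : Oracle κ e ℓ) (K : Fin L → Bits κ) (ω : Fin A.o)
    (p : Fin T × Bool) : Bits ℓ := fun i =>
  if h : i < (A.encQuery ω p.1).f.outLen then
    !p.2 && b && (A.encQuery ω p.1).f.eval H K (A.encQuery ω p.1).msg ⟨i, h⟩
  else false

/-- The oracle inputs used by the challenger. -/
def input (K : Fin L → Bits κ) (R : Fin T → Bits κ × Bits κ) (ω : Fin A.o)
    (p : Fin T × Bool) : OracleIn κ e :=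
  concat (K (A.encQuery ω p.1).idx) (coin R p)

theorem answers_eq_assemble (b : Bool) (H : Oracle κ e ℓ) (K : Fin L → Bits κ)
    (R : Fin T → Bits κ × Bits κ) (ω : Fin A.o) :
    A.answers b H K R ω
      = A.assemble ω R (fun p => bxor (H (A.input K R ω p)) (A.mask b H K ω p)) := by
  funext j
  simp only [answers, enc, assemble, Ciphertext.mk.injEq, Prod.mk.injEq, true_and]
  constructor
  · funext i
    cases b <;> simp [bxor, mask, input, coin]
  · funext i
    simp [bxor, mask, input, coin]

theorem probOne_eq (b : Bool) :
    A.probOne b = 𝔼 H : Oracle κ e ℓ, 𝔼 K : Fin L → Bits κ, 𝔼 R : Fin T → Bits κ × Bits κ,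
      ∑ ω : Fin A.o, A.acceptProb H H ω
        (A.assemble ω R (fun p => bxor (H (A.input K R ω p)) (A.mask b H K ω p))) := by
  simp only [← answers_eq_assemble]
  rfl

/-- Distinct coins suffice, even if keys coincide or are reused. -/
theorem input_injective (K : Fin L → Bits κ) {R : Fin T → Bits κ × Bits κ}
    (hR : Function.Injective (coin R)) (ω : Fin A.o) : Function.Injective (A.input K R ω) :=
  fun _ _ h => hR (concat_inj h).2

theorem sum_norm_midState_sq (H : Oracle κ e ℓ) : ∑ ω, ‖A.midState H ω‖ ^ 2 = 1 := by
  simp only [midState]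
  rw [sum_norm_restrict_sq, norm_runCircuit]
  simp

theorem acceptProb_nonneg (H₁ H₂ : Oracle κ e ℓ) (ω : Fin A.o)
    (a : (j : Fin T) → Ciphertext κ ℓ (A.encQuery ω j).f.outLen) :
    0 ≤ A.acceptProb H₁ H₂ ω a := by
  unfold acceptProb
  positivity

theorem acceptProb_le (H₁ H₂ : Oracle κ e ℓ) (ω : Fin A.o)
    (a : (j : Fin T) → Ciphertext κ ℓ (A.encQuery ω j).f.outLen) :
    A.acceptProb H₁ H₂ ω a ≤ ‖A.midState H₁ ω‖ ^ 2 := by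
  refine pow_le_pow_left₀ (norm_nonneg _) ((norm_restrict_le _ _).trans ?_) 2
  rw [norm_runCircuit]

/-! ### The cost of each change of oracle -/

/-- Changing the oracle of the first phase. -/
theorem sum_abs_acceptProb_fst_sub_le {s : OracleIn κ e → Bool} {H H' : Oracle κ e ℓ}
    (h : ∀ x, s x = false → H' x = H x) (H₂ : Oracle κ e ℓ)
    (a : (ω : Fin A.o) → (j : Fin T) → Ciphertext κ ℓ (A.encQuery ω j).f.outLen)
    {ε : ℝ} (hε : 0 < ε) :
    ∑ ω, |A.acceptProb H' H₂ ω (a ω) - A.acceptProb H H₂ ω (a ω)|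
      ≤ 2 * ε + 2 * A.n₁ / ε * ∑ t ∈ Finset.range A.n₁,
        ‖restrict (fun z => s z.1)
          (runCircuit H A.U₁ t (EuclideanSpace.single A.init 1))‖ ^ 2 := by
  have h₁ : ∀ ω, |A.acceptProb H' H₂ ω (a ω) - A.acceptProb H H₂ ω (a ω)|
      ≤ ε * (‖A.midState H' ω‖ ^ 2 + ‖A.midState H ω‖ ^ 2)
        + ‖A.midState H' ω - A.midState H ω‖ ^ 2 / (2 * ε) := by
    intro ω
    refine (abs_norm_sq_sub_norm_sq_le _ _ hε).trans ?_
    rw [← restrict_sub, ← runCircuit_sub]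
    have hb : ∀ φ, ‖restrict A.accept (runCircuit H₂ (A.U₂ ω (a ω)) A.n₂ φ)‖ ≤ ‖φ‖ := by
      intro φ
      refine (norm_restrict_le _ _).trans ?_
      rw [norm_runCircuit]
    gcongr <;> exact hb _
  refine (Finset.sum_le_sum fun ω _ => h₁ ω).trans ?_
  rw [Finset.sum_add_distrib, ← Finset.mul_sum, Finset.sum_add_distrib, ← Finset.sum_div,
    sum_norm_midState_sq, sum_norm_midState_sq]
  -- The outcomes split the state orthogonally, so no factor of `A.o` is lost.
  have h₂ : ∑ ω, ‖A.midState H' ω - A.midState H ω‖ ^ 2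
      = ‖runCircuit H' A.U₁ A.n₁ (EuclideanSpace.single A.init 1)
        - runCircuit H A.U₁ A.n₁ (EuclideanSpace.single A.init 1)‖ ^ 2 := by
    simp only [midState, ← restrict_sub]
    exact sum_norm_restrict_sq _ _
  rw [h₂]
  have h₃ := norm_runCircuit_sub_sq_le h A.U₁ A.n₁ (EuclideanSpace.single A.init 1)
  have h₄ := div_le_div_of_nonneg_right h₃ (by positivity : 0 ≤ 2 * ε)
  refine (add_le_add_right h₄ _).trans (le_of_eq ?_)
  field_simp
  ring

/-- Changing the oracle of the second phase. -/
theorem abs_acceptProb_snd_sub_le {s : OracleIn κ e → Bool} {H H' : Oracle κ e ℓ}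
    (h : ∀ x, s x = false → H' x = H x) (H₁ : Oracle κ e ℓ) (ω : Fin A.o)
    (a : (j : Fin T) → Ciphertext κ ℓ (A.encQuery ω j).f.outLen)
    {ε : ℝ} (hε : 0 < ε) :
    |A.acceptProb H₁ H' ω a - A.acceptProb H₁ H ω a|
      ≤ 2 * ε * ‖A.midState H₁ ω‖ ^ 2 + 2 * A.n₂ / ε * ∑ t ∈ Finset.range A.n₂,
        ‖restrict (fun z => s z.1) (runCircuit H (A.U₂ ω a) t (A.midState H₁ ω))‖ ^ 2 := by
  refine (abs_norm_sq_sub_norm_sq_le _ _ hε).trans ?_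
  rw [← restrict_sub]
  have h₁ := A.acceptProb_le H₁ H' ω a
  have h₂ := A.acceptProb_le H₁ H ω a
  unfold acceptProb at h₁ h₂
  have h₃ := (pow_le_pow_left₀ (norm_nonneg _) (norm_restrict_le A.accept
    (runCircuit H' (A.U₂ ω a) A.n₂ (A.midState H₁ ω)
      - runCircuit H (A.U₂ ω a) A.n₂ (A.midState H₁ ω))) 2).trans
    (norm_runCircuit_sub_sq_le h (A.U₂ ω a) A.n₂ (A.midState H₁ ω))
  have h₄ := div_le_div_of_nonneg_right h₃ (by positivity : 0 ≤ 2 * ε)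
  refine (add_le_add (mul_le_mul_of_nonneg_left (add_le_add h₁ h₂) hε.le) h₄).trans
    (le_of_eq ?_)
  field_simp
  ring

/-- The number of queries to the points that the functions make. -/
def pointQueries (H : Oracle κ e ℓ) (K : Fin L → Bits κ) (R : Fin T → Bits κ × Bits κ)
    (ω : Fin A.o) : ℝ :=
  ∑ j, ((((A.encQuery ω j).f.prog K (A.encQuery ω j).msg).queries H).map
    (fun x => if points K R x then (1 : ℝ) else 0)).sum

theorem list_sum_boole_nonneg {β : Type} (s : β → Bool) (l : List β) :
    0 ≤ (l.map (fun x => if s x then (1 : ℝ) else 0)).sum := by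
  refine List.sum_nonneg fun y hy => ?_
  obtain ⟨x, -, rfl⟩ := List.mem_map.1 hy
  positivity

theorem one_le_list_sum_boole {β : Type} (s : β → Bool) (l : List β) {x : β} (hx : x ∈ l)
    (hs : s x = true) : 1 ≤ (l.map (fun x => if s x then (1 : ℝ) else 0)).sum := by
  refine le_trans ?_ (List.single_le_sum (l := l.map (fun x => if s x then (1 : ℝ) else 0)) ?_
    1 (List.mem_map.2 ⟨x, hx, by simp [hs]⟩))
  · exact le_rfl
  · intro y hy
    obtain ⟨x, -, rfl⟩ := List.mem_map.1 hy
    positivity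

/-- Reprogramming the points changes the messages only if a function queries a point. -/
theorem mask_merge_eq_or (b : Bool) (H G : Oracle κ e ℓ) (K : Fin L → Bits κ)
    (R : Fin T → Bits κ × Bits κ) (ω : Fin A.o) :
    A.mask b (merge (points K R) H G) K ω = A.mask b H K ω ∨ 1 ≤ A.pointQueries H K R ω := by
  by_cases hq : ∃ j, ∃ x ∈ ((A.encQuery ω j).f.prog K (A.encQuery ω j).msg).queries H,
      points K R x = true
  · obtain ⟨j, x, hx, hs⟩ := hq
    right
    exact (one_le_list_sum_boole (points K R) _ hx hs).trans
      (Finset.single_le_sum (f := fun j =>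
        ((((A.encQuery ω j).f.prog K (A.encQuery ω j).msg).queries H).map
          (fun x => if points K R x then (1 : ℝ) else 0)).sum)
        (fun j _ => list_sum_boole_nonneg _ _) (Finset.mem_univ j))
  · left
    push Not at hq
    funext p i
    have : (A.encQuery ω p.1).f.eval (merge (points K R) H G) K (A.encQuery ω p.1).msg
        = (A.encQuery ω p.1).f.eval H K (A.encQuery ω p.1).msg :=
      OracleProg.eval_congr _ fun x hx =>
        merge_of_false (by simpa using hq p.1 x hx) H G
    simp only [mask, this]

/-- This is where nonadaptivity enters: for fixed `H`, `K`, `ω` the at most `T * q'` queries do not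
depend on the coins. -/
theorem expect_pointQueries_le (H : Oracle κ e ℓ) (K : Fin L → Bits κ) (ω : Fin A.o) :
    𝔼 R : Fin T → Bits κ × Bits κ, A.pointQueries H K R ω
      ≤ 2 * T ^ 2 * q' * (2 ^ κ : ℝ)⁻¹ := by
  simp only [pointQueries]
  rw [Finset.expect_sum_comm]
  calc _ ≤ ∑ j : Fin T, q' * (2 * T * (2 ^ κ : ℝ)⁻¹) := by
        refine Finset.sum_le_sum fun j _ => ?_
        refine (expect_list_sum_le (fun (R : Fin T → Bits κ × Bits κ) x =>
          if points K R x then (1 : ℝ) else 0) (fun x => expect_points_coins_le K x) _).trans ?_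
        refine mul_le_mul_of_nonneg_right ?_ (by positivity)
        exact_mod_cast OracleProg.length_queries_le H _ _ ((A.encQuery ω j).f.prog_queries K _)
    _ = _ := by
        simp
        ring

/-- Changing the oracle under which the messages are computed. -/
theorem abs_acceptProb_assemble_sub_le (b : Bool) (H G H₁ H₂ : Oracle κ e ℓ)
    (K : Fin L → Bits κ) (R : Fin T → Bits κ × Bits κ) (ω : Fin A.o)
    (r : Fin T × Bool → Bits ℓ) :
    |A.acceptProb H₁ H₂ ω
        (A.assemble ω R (fun p => bxor (r p) (A.mask b (merge (points K R) H G) K ω p)))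
      - A.acceptProb H₁ H₂ ω (A.assemble ω R (fun p => bxor (r p) (A.mask b H K ω p)))|
      ≤ ‖A.midState H₁ ω‖ ^ 2 * A.pointQueries H K R ω := by
  rcases A.mask_merge_eq_or b H G K R ω with h | h
  · rw [h, sub_self, abs_zero]
    exact mul_nonneg (by positivity)
      (Finset.sum_nonneg fun j _ => list_sum_boole_nonneg _ _)
  -- If a message may have changed, the trivial bound by the mass of `ω` is enough.
  · refine le_trans ?_ (le_mul_of_one_le_right (by positivity) h)
    refine abs_sub_le_of_nonneg_of_le ?_ ?_ ?_ ?_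
    · exact A.acceptProb_nonneg ..
    · exact A.acceptProb_le ..
    · exact A.acceptProb_nonneg ..
    · exact A.acceptProb_le ..

/-- The three changes together: the game with a reprogrammed oracle against the game in which the
reprogrammed values occur only in the answers. -/
theorem sum_abs_acceptProb_merge_sub_le (b : Bool) (H G : Oracle κ e ℓ) (K : Fin L → Bits κ)
    (R : Fin T → Bits κ × Bits κ) {ε : ℝ} (hε : 0 < ε) :
    ∑ ω, |A.acceptProb (merge (points K R) H G) (merge (points K R) H G) ω
        (A.assemble ω R (fun p => bxor (merge (points K R) H G (A.input K R ω p))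
          (A.mask b (merge (points K R) H G) K ω p)))
      - A.acceptProb H H ω
        (A.assemble ω R (fun p => bxor (G (A.input K R ω p)) (A.mask b H K ω p)))|
      ≤ (2 * ε + 2 * A.n₁ / ε * ∑ t ∈ Finset.range A.n₁,
          ‖restrict (fun z => points K R z.1)
            (runCircuit H A.U₁ t (EuclideanSpace.single A.init 1))‖ ^ 2)
        + ∑ ω, ‖A.midState H ω‖ ^ 2 * A.pointQueries H K R ω
        + (2 * ε + 2 * A.n₂ / ε * ∑ ω, ∑ t ∈ Finset.range A.n₂,
          ‖restrict (fun z => points K R z.1) (runCircuit H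
            (A.U₂ ω (A.assemble ω R
              (fun p => bxor (G (A.input K R ω p)) (A.mask b H K ω p)))) t
            (A.midState H ω))‖ ^ 2) := by
  have hag : ∀ x, points K R x = false → merge (points K R) H G x = H x :=
    fun x hx => merge_of_false hx H G
  -- The challenger only queries points, so its pads and tags come from `G`.
  have hin : ∀ ω p, merge (points K R) H G (A.input K R ω p) = G (A.input K R ω p) :=
    fun ω p => merge_of_true (points_concat K R _ p) H G
  simp only [hin]
  have h₁ := A.sum_abs_acceptProb_fst_sub_le hag (merge (points K R) H G)
    (fun ω => A.assemble ω R (fun p => bxor (G (A.input K R ω p))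
      (A.mask b (merge (points K R) H G) K ω p))) hε
  have h₂ := Finset.sum_le_sum fun ω (_ : ω ∈ Finset.univ) =>
    A.abs_acceptProb_assemble_sub_le b H G H (merge (points K R) H G) K R ω
      (fun p => G (A.input K R ω p))
  have h₃ := Finset.sum_le_sum fun ω (_ : ω ∈ Finset.univ) =>
    A.abs_acceptProb_snd_sub_le hag H ω
      (A.assemble ω R (fun p => bxor (G (A.input K R ω p)) (A.mask b H K ω p))) hε
  rw [Finset.sum_add_distrib, ← Finset.mul_sum, ← Finset.mul_sum, sum_norm_midState_sq,
    mul_one] at h₃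
  refine le_trans ?_ (add_le_add (add_le_add h₁ h₂) h₃)
  rw [← Finset.sum_add_distrib, ← Finset.sum_add_distrib]
  refine Finset.sum_le_sum fun ω _ => ?_
  exact (abs_sub_le _ _ _).trans (add_le_add_left (abs_sub_le _ _ _) _)

/-! ### Comparison with the ideal game -/

/-- The game in which the answers are uniform and independent of the oracle and of the keys. -/
def idealProb (R : Fin T → Bits κ × Bits κ) : ℝ :=
  𝔼 H : Oracle κ e ℓ, ∑ ω, 𝔼 r : Fin T × Bool → Bits ℓ,
    A.acceptProb H H ω (A.assemble ω R r)

/-- The game with challenge bit `b`, for given coins. -/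
def realProb (b : Bool) (R : Fin T → Bits κ × Bits κ) : ℝ :=
  𝔼 K : Fin L → Bits κ, 𝔼 H : Oracle κ e ℓ, ∑ ω : Fin A.o, A.acceptProb H H ω
    (A.assemble ω R (fun p => bxor (H (A.input K R ω p)) (A.mask b H K ω p)))

theorem probOne_eq_expect_realProb (b : Bool) :
    A.probOne b = 𝔼 R : Fin T → Bits κ × Bits κ, A.realProb b R := by
  rw [probOne_eq, Finset.expect_comm]
  simp only [realProb]
  rw [Finset.expect_comm (Finset.univ : Finset (Fin T → Bits κ × Bits κ))]
  exact Finset.expect_congr rfl fun K _ => Finset.expect_comm _ _ _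

theorem realProb_mem_Icc (b : Bool) (R : Fin T → Bits κ × Bits κ) :
    0 ≤ A.realProb b R ∧ A.realProb b R ≤ 1 := by
  constructor
  · exact Finset.expect_nonneg fun K _ => Finset.expect_nonneg fun H _ =>
      Finset.sum_nonneg fun ω _ => A.acceptProb_nonneg ..
  · refine Finset.expect_le Finset.univ_nonempty fun K _ =>
      Finset.expect_le Finset.univ_nonempty fun H _ => ?_
    exact (Finset.sum_le_sum fun ω _ => A.acceptProb_le ..).trans
      (A.sum_norm_midState_sq H).le

/-- With distinct coins, the values in the answers are uniform. -/
theorem expect_expect_expect_sum_comp_input (b : Bool) {R : Fin T → Bits κ × Bits κ}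
    (hR : Function.Injective (coin R))
    (F : (Fin L → Bits κ) → Oracle κ e ℓ → (ω : Fin A.o) → (Fin T × Bool → Bits ℓ) → ℝ) :
    𝔼 K : Fin L → Bits κ, 𝔼 H : Oracle κ e ℓ, 𝔼 G : Oracle κ e ℓ, ∑ ω,
        F K H ω (fun p => bxor (G (A.input K R ω p)) (A.mask b H K ω p))
      = 𝔼 H : Oracle κ e ℓ, ∑ ω, 𝔼 r : Fin T × Bool → Bits ℓ,
        𝔼 K : Fin L → Bits κ, F K H ω r := by
  rw [Finset.expect_comm]
  refine Finset.expect_congr rfl fun H _ => ?_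
  -- The masks depend on `H` but not on `G`, so `G` hides them completely. The average over the keys
  -- can then be moved innermost, past the answers.
  calc _ = 𝔼 K : Fin L → Bits κ, ∑ ω, 𝔼 r : Fin T × Bool → Bits ℓ, F K H ω r := by
        refine Finset.expect_congr rfl fun K _ => ?_
        rw [Finset.expect_sum_comm]
        exact Finset.sum_congr rfl fun ω _ =>
          expect_comp_injective (A.input_injective K hR ω) (A.mask b H K ω) (F K H ω)
    _ = _ := by
        rw [Finset.expect_sum_comm]
        exact Finset.sum_congr rfl fun ω _ => Finset.expect_comm _ _ _

/-- The `pointQueries` term stays unevaluated: its bound needs the average over the coins, which are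
fixed here. -/
theorem abs_realProb_sub_idealProb_le (b : Bool) {R : Fin T → Bits κ × Bits κ}
    (hR : Function.Injective (coin R)) {ε : ℝ} (hε : 0 < ε) (hκ : (2 ^ κ : ℝ)⁻¹ = ε ^ 2) :
    |A.realProb b R - A.idealProb R|
      ≤ (4 + 2 * q ^ 2 * L) * ε
        + 𝔼 K : Fin L → Bits κ, 𝔼 H : Oracle κ e ℓ,
          ∑ ω, ‖A.midState H ω‖ ^ 2 * A.pointQueries H K R ω := by
  have hreal : A.realProb b R = 𝔼 K : Fin L → Bits κ, 𝔼 H : Oracle κ e ℓ, 𝔼 G : Oracle κ e ℓ,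
      ∑ ω, A.acceptProb (merge (points K R) H G) (merge (points K R) H G) ω
        (A.assemble ω R (fun p => bxor (merge (points K R) H G (A.input K R ω p))
          (A.mask b (merge (points K R) H G) K ω p))) :=
    Finset.expect_congr rfl fun K _ => (expect_merge (points K R) (fun H => ∑ ω,
      A.acceptProb H H ω (A.assemble ω R
        (fun p => bxor (H (A.input K R ω p)) (A.mask b H K ω p))))).symm
  have hideal : A.idealProb R = 𝔼 K : Fin L → Bits κ, 𝔼 H : Oracle κ e ℓ, 𝔼 G : Oracle κ e ℓ,
      ∑ ω, A.acceptProb H H ω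
        (A.assemble ω R (fun p => bxor (G (A.input K R ω p)) (A.mask b H K ω p))) := by
    rw [A.expect_expect_expect_sum_comp_input b hR
      (fun K H ω r => A.acceptProb H H ω (A.assemble ω R r))]
    simp only [Fintype.expect_const, idealProb]
  have hfst : ∀ H : Oracle κ e ℓ, 𝔼 K : Fin L → Bits κ, ∑ t ∈ Finset.range A.n₁,
      ‖restrict (fun z => points K R z.1)
        (runCircuit H A.U₁ t (EuclideanSpace.single A.init 1))‖ ^ 2 ≤ A.n₁ * (L * ε ^ 2) := by
    intro H
    rw [Finset.expect_sum_comm]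
    refine (Finset.sum_le_sum fun t _ => expect_norm_restrict_points_sq_le R _).trans ?_
    simp [norm_runCircuit, hκ]
  have hsnd : 𝔼 K : Fin L → Bits κ, 𝔼 H : Oracle κ e ℓ, 𝔼 G : Oracle κ e ℓ,
      ∑ ω, ∑ t ∈ Finset.range A.n₂,
        ‖restrict (fun z => points K R z.1) (runCircuit H
          (A.U₂ ω (A.assemble ω R
            (fun p => bxor (G (A.input K R ω p)) (A.mask b H K ω p)))) t
          (A.midState H ω))‖ ^ 2 ≤ A.n₂ * (L * ε ^ 2) := by
    rw [A.expect_expect_expect_sum_comp_input b hR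
      (fun K H ω r => ∑ t ∈ Finset.range A.n₂,
        ‖restrict (fun z => points K R z.1) (runCircuit H
          (A.U₂ ω (A.assemble ω R r)) t (A.midState H ω))‖ ^ 2)]
    refine Finset.expect_le Finset.univ_nonempty fun H _ => ?_
    calc _ ≤ ∑ ω, A.n₂ * (L * ε ^ 2) * ‖A.midState H ω‖ ^ 2 := by
          refine Finset.sum_le_sum fun ω _ =>
            Finset.expect_le Finset.univ_nonempty fun r _ => ?_
          rw [Finset.expect_sum_comm]
          refine (Finset.sum_le_sum fun t _ => expect_norm_restrict_points_sq_le R _).trans ?_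
          simp [norm_runCircuit, hκ, mul_assoc]
      _ = _ := by rw [← Finset.mul_sum, sum_norm_midState_sq, mul_one]
  have hq : (A.n₁ : ℝ) ^ 2 + (A.n₂ : ℝ) ^ 2 ≤ (q : ℝ) ^ 2 := by
    have h₁ : (A.n₁ : ℝ) + A.n₂ ≤ q := by exact_mod_cast A.queries_le
    have h₂ : (0 : ℝ) ≤ A.n₁ := Nat.cast_nonneg _
    have h₃ : (0 : ℝ) ≤ A.n₂ := Nat.cast_nonneg _
    nlinarith [mul_nonneg h₂ h₃]
  rw [hreal, hideal]
  simp only [← Finset.expect_sub_distrib, ← Finset.sum_sub_distrib]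
  have hpt : ∀ (K : Fin L → Bits κ) (H G : Oracle κ e ℓ), _ :=
    fun K H G => (Finset.abs_sum_le_sum_abs _ _).trans
      (A.sum_abs_acceptProb_merge_sub_le b H G K R hε)
  refine (Finset.abs_expect_le _ _).trans ((Finset.expect_le_expect fun K _ =>
    (Finset.abs_expect_le _ _).trans (Finset.expect_le_expect fun H _ =>
      (Finset.abs_expect_le _ _).trans (Finset.expect_le_expect fun G _ =>
        hpt K H G))).trans ?_)
  simp only [Finset.expect_add_distrib, Fintype.expect_const, ← Finset.mul_expect]
  have hfst' : 𝔼 K : Fin L → Bits κ, 𝔼 H : Oracle κ e ℓ, ∑ t ∈ Finset.range A.n₁,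
      ‖restrict (fun z => points K R z.1)
        (runCircuit H A.U₁ t (EuclideanSpace.single A.init 1))‖ ^ 2 ≤ A.n₁ * (L * ε ^ 2) := by
    rw [Finset.expect_comm]
    exact Finset.expect_le Finset.univ_nonempty fun H _ => hfst H
  -- The weight `ε²` on the points, divided by `ε`, balances the `2 * ε` terms; hence the choice `ε
  -- = 2^(-κ/2)`.
  have h₁ := mul_le_mul_of_nonneg_left hfst' (by positivity : 0 ≤ 2 * (A.n₁ : ℝ) / ε)
  have h₂ := mul_le_mul_of_nonneg_left hsnd (by positivity : 0 ≤ 2 * (A.n₂ : ℝ) / ε)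
  have e₁ : 2 * (A.n₁ : ℝ) / ε * (A.n₁ * (L * ε ^ 2)) = 2 * A.n₁ ^ 2 * (L * ε) := by
    field_simp
  have e₂ : 2 * (A.n₂ : ℝ) / ε * (A.n₂ * (L * ε ^ 2)) = 2 * A.n₂ ^ 2 * (L * ε) := by
    field_simp
  have h₃ := mul_le_mul_of_nonneg_right hq (by positivity : 0 ≤ 2 * (L * ε))
  rw [e₁] at h₁
  rw [e₂] at h₂
  linarith

/-- Passing through the ideal game doubles the cost of one comparison; colliding coins are charged
the trivial bound `1`. -/
theorem advantage_le {ε : ℝ} (hε : 0 < ε) (hκ : (2 ^ κ : ℝ)⁻¹ = ε ^ 2) :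
    A.advantage ≤ (8 + 4 * q ^ 2 * L) * ε + (4 * T ^ 2 * q' + 4 * T ^ 2) * ε ^ 2 := by
  classical
  set C : ℝ := (4 + 2 * q ^ 2 * L) * ε
  have hC : 0 ≤ C := by positivity
  set B : (Fin T → Bits κ × Bits κ) → ℝ := fun R => 𝔼 K : Fin L → Bits κ, 𝔼 H : Oracle κ e ℓ,
    ∑ ω, ‖A.midState H ω‖ ^ 2 * A.pointQueries H K R ω with hB
  have hB₀ : ∀ R, 0 ≤ B R := fun R =>
    Finset.expect_nonneg fun K _ => Finset.expect_nonneg fun H _ => Finset.sum_nonneg fun ω _ =>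
      mul_nonneg (by positivity) (Finset.sum_nonneg fun j _ => list_sum_boole_nonneg _ _)
  have hB₁ : 𝔼 R, B R ≤ 2 * T ^ 2 * q' * ε ^ 2 := by
    simp only [hB]
    rw [Finset.expect_comm]
    refine Finset.expect_le Finset.univ_nonempty fun K _ => ?_
    rw [Finset.expect_comm]
    refine Finset.expect_le Finset.univ_nonempty fun H _ => ?_
    rw [Finset.expect_sum_comm]
    simp only [← Finset.mul_expect]
    refine (Finset.sum_le_sum fun ω _ => mul_le_mul_of_nonneg_left
      (A.expect_pointQueries_le H K ω) (by positivity)).trans ?_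
    rw [← Finset.sum_mul, sum_norm_midState_sq, one_mul, hκ]
  have hR : ∀ R, |A.realProb true R - A.realProb false R|
      ≤ 2 * C + 2 * B R + if Function.Injective (coin R) then (0 : ℝ) else 1 := by
    intro R
    split_ifs with h
    · have h₁ := A.abs_realProb_sub_idealProb_le true h hε hκ
      have h₂ := A.abs_realProb_sub_idealProb_le false h hε hκ
      have h₃ := abs_sub_le (A.realProb true R) (A.idealProb R) (A.realProb false R)
      rw [abs_sub_comm (A.idealProb R)] at h₃
      change _ ≤ C + B R at h₁
      change _ ≤ C + B R at h₂
      linarith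
    · have h₁ := abs_sub_le_of_nonneg_of_le (A.realProb_mem_Icc true R).1
        (A.realProb_mem_Icc true R).2 (A.realProb_mem_Icc false R).1
        (A.realProb_mem_Icc false R).2
      linarith [hB₀ R]
  have hfin : A.advantage ≤ 2 * C + 2 * (𝔼 R, B R) + 4 * T ^ 2 * ε ^ 2 := by
    rw [advantage, probOne_eq_expect_realProb, probOne_eq_expect_realProb,
      ← Finset.expect_sub_distrib]
    refine (Finset.abs_expect_le _ _).trans
      ((Finset.expect_le_expect fun R _ => hR R).trans ?_)
    rw [Finset.expect_add_distrib, Finset.expect_add_distrib, Fintype.expect_const,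
      ← Finset.mul_expect, ← hκ]
    exact add_le_add_right expect_not_injective_coin_le _
  calc A.advantage ≤ _ := hfin
    _ ≤ 2 * C + 2 * (2 * T ^ 2 * q' * ε ^ 2) + 4 * T ^ 2 * ε ^ 2 := by gcongr
    _ = _ := by ring

/-- The concrete security bound. -/
theorem advantage_le_mul_two_rpow :
    A.advantage ≤ (8 + 4 * q ^ 2 * L + 4 * T ^ 2 * q' + 4 * T ^ 2)
      * (2 : ℝ) ^ (-(0.5 * (κ : ℝ))) := by
  set ε : ℝ := (2 : ℝ) ^ (-(0.5 * (κ : ℝ))) with hεdef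
  have hε : 0 < ε := by positivity
  have hε₁ : ε ≤ 1 := Real.rpow_le_one_of_one_le_of_nonpos one_le_two (by
    have : (0 : ℝ) ≤ κ := Nat.cast_nonneg _
    linarith)
  have hκ : (2 ^ κ : ℝ)⁻¹ = ε ^ 2 := by
    rw [hεdef, ← Real.rpow_natCast, ← Real.rpow_neg zero_le_two, ← Real.rpow_natCast,
      ← Real.rpow_mul zero_le_two]
    congr 1
    push_cast
    ring
  have h₁ : ε ^ 2 ≤ ε := by nlinarith
  refine (A.advantage_le hε hκ).trans ?_
  have h₂ := mul_le_mul_of_nonneg_left h₁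
    (by positivity : (0 : ℝ) ≤ 4 * T ^ 2 * q' + 4 * T ^ 2)
  linarith

theorem advantage_nonneg : 0 ≤ A.advantage := abs_nonneg _

end Adversary

theorem superpolynomialDecay_two_rpow :
    Asymptotics.SuperpolynomialDecay Filter.atTop (fun κ : ℕ => (κ : ℝ))
      (fun κ : ℕ => (2 : ℝ) ^ (-(0.5 * (κ : ℝ)))) := by
  intro n
  have h : ∀ κ : ℕ, (2 : ℝ) ^ (-(0.5 * (κ : ℝ))) = ((2 : ℝ) ^ (-(0.5 : ℝ))) ^ κ := by
    intro κ
    rw [← Real.rpow_natCast, ← Real.rpow_mul zero_le_two, neg_mul]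
  simp only [h]
  refine tendsto_pow_const_mul_const_pow_of_abs_lt_one n ?_
  rw [abs_of_pos (by positivity)]
  exact Real.rpow_lt_one_of_one_lt_of_neg one_lt_two (by norm_num)

end KDM

end

theorem theorem5 :
    -- the concrete bound, with one fixed polynomial in `q`, `q'`, `L`, `T`
    (∃ P : MvPolynomial (Fin 4) ℝ,
      ∀ (κ e ℓ L T q q' : ℕ) (A : KDM.Adversary κ e ℓ L T q q'),
        A.advantage ≤
          MvPolynomial.eval ![(q : ℝ), (q' : ℝ), (L : ℝ), (T : ℝ)] P *
            (2 : ℝ) ^ (-(0.5 * (κ : ℝ)))) ∧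
    -- asymptotic nonadaptive KDM security: negligible advantage for polynomial parameters
    (∀ e ℓ L T q q' : ℕ → ℕ,
      KDM.PolyBounded L → KDM.PolyBounded T → KDM.PolyBounded q → KDM.PolyBounded q' →
      ∀ A : (κ : ℕ) → KDM.Adversary κ (e κ) (ℓ κ) (L κ) (T κ) (q κ) (q' κ),
        Asymptotics.SuperpolynomialDecay Filter.atTop (fun κ : ℕ => (κ : ℝ))
          (fun κ => (A κ).advantage)) := by
  -- The variables `X 0`, `X 1`, `X 2`, `X 3` stand for `q`, `q'`, `L`, `T`.
  refine ⟨⟨MvPolynomial.C 8 + MvPolynomial.C 4 * MvPolynomial.X 0 ^ 2 * MvPolynomial.X 2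
    + MvPolynomial.C 4 * MvPolynomial.X 3 ^ 2 * MvPolynomial.X 1
    + MvPolynomial.C 4 * MvPolynomial.X 3 ^ 2, fun κ e ℓ L T q q' A => ?_⟩, ?_⟩
  · simpa using A.advantage_le_mul_two_rpow
  · rintro e ℓ L T q q' ⟨pL, hL⟩ ⟨pT, hT⟩ ⟨pq, hq⟩ ⟨pq', hq'⟩ A
    -- The concrete bound is monotone in the parameters, so their polynomial bounds can be
    -- substituted.
    let Q : Polynomial ℕ := 8 + 4 * pq ^ 2 * pL + 4 * pT ^ 2 * pq' + 4 * pT ^ 2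
    refine (KDM.superpolynomialDecay_two_rpow.polynomial_mul
      (Q.map (Nat.castRingHom ℝ))).trans_abs_le fun κ => ?_
    rw [abs_of_nonneg (A κ).advantage_nonneg]
    refine le_trans ((A κ).advantage_le_mul_two_rpow.trans ?_) (le_abs_self _)
    refine mul_le_mul_of_nonneg_right ?_ (by positivity)
    have h : 8 + 4 * q κ ^ 2 * L κ + 4 * T κ ^ 2 * q' κ + 4 * T κ ^ 2 ≤ Q.eval κ := by
      simp only [Q, Polynomial.eval_add, Polynomial.eval_mul, Polynomial.eval_pow,
        Polynomial.eval_ofNat]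
      gcongr
      exacts [hq κ, hL κ, hT κ, hq' κ, hT κ]
    rw [Polynomial.eval_natCast_map, eq_natCast]
    exact_mod_cast h
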